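/- For $\kappa\in\{0,1,-1\}$ let $M_\kappa$ be the oriented three-dimensional space form of curvature $\kappa$: $M_0=\mathbb R^3$ (identified with $\{x\in\mathbb R^4: x_0=1\}$), $M_1=S^3\subset\mathbb R^4$, and $M_{-1}=H^3=\{x\in\mathbb R^4:\langle x,x\rangle_{-1}=-1,\ x_0>0\}$, with the Riemannian metric induced by $\langle x,y\rangle_\kappa=\kappa x_0y_0+x_1y_1+x_2y_2+x_3y_3$. The cross product on $T_pM_\kappa$ is the bilinear map such that, for orthonormal $u,v$, $u\times v$ is the unit vector $w$ for which $(p,u,v,w)$ is a positively oriented orthogonal basis of $\mathbb R^4$. Let $\mathcal G_\kappa$ be the manifold of complete oriented geodesics $[\sigma]$ of $M_\kappa$ ($\sigma:\mathbb R\to M_\kappa$ a unit speed geodesic, up to translation of the parameter), with its differentiable structure as a homogeneous space of the identity component of the isometry group of $M_\kappa$. Let $\alpha\in\mathbb R$. Given $\ell\in\mathcal G_\kappa$, $p\in\ell$ and a unit vector $A\in T_pM_\kappa$ orthogonal to $\ell$, write $\ell=[\sigma]$ with $\sigma(0)=p$, let $\gamma_A$ be the geodesic with initial velocity $A$, and let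 $V_t,B_t$ be the parallel fields along $\gamma_A$ with initial values $\sigma'(0)$ and $A\times\sigma'(0)$. Let $s\mapsto\phi(s,t)$ be the geodesic starting at $\gamma_A(t)$ with initial velocity $\cos(\alpha t)V_t+\sin(\alpha t)B_t$. The curve $t\mapsto[s\mapsto\phi(s,t)]$ in $\mathcal G_\kappa$ is called $\alpha$-helicoidal, and a tangent vector of $\mathcal G_\kappa$ is called $\alpha$-admissible if it is the initial velocity of some $\alpha$-helicoidal curve. For a unit speed geodesic $\sigma$ of $M_\kappa$ let $\mathcal J_\sigma$ be the set of Jacobi fields $J(s)=\frac{d}{dt}\big|_0\varphi_t(s)$ associated with smooth variations $\varphi_t$ ($|t|<\varepsilon$) of $\sigma=\varphi_0$ by unit speed geodesics $\varphi_t:\mathbb R\to M_\kappa$, and let $\mathcal T_\sigma:\mathcal J_\sigma\to T_{[\sigma]}\mathcal G_\kappa$, $\mathcal T_\sigma(J)=\frac{d}{dt}\big|_0[\varphi_t]$, which does not depend on the choice of the variation. Write $J'=\frac{DJ}{ds}$ for the covariant derivative along $\sigma$. **Proposition.** Let $\kappa\in\{0,1,-1\}$, $\alpha\neq0$, let $\sigma$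 be a unit speed geodesic of $M_\kappa$ and let $J\in\mathcal J_\sigma$ with $J(0)\perp J'(0)$. If $$\|J'(0)\|=|\alpha|\qquad\text{and}\qquad J'(0)=\alpha\,J(0)\times\sigma'(0),$$ then $\mathcal T_\sigma(J)$ is $\alpha$-admissible. Moreover, if $\kappa\in\{0,-1\}$, the converse holds: if $\mathcal T_\sigma(J)$ is $\alpha$-admissible, then both equations hold. -/

import Mathlib

open scoped ContDiff

noncomputable section

namespace SpaceForm

/-- The ambient space `ℝ⁴`, with coordinates `x 0, x 1, x 2, x 3`. -/
abbrev E4 : Type := Fin 4 → ℝ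

/-- The bilinear form `⟨x, y⟩_κ = κ x₀ y₀ + x₁ y₁ + x₂ y₂ + x₃ y₃`. -/
def form (κ : ℝ) (x y : E4) : ℝ :=
  κ * (x 0 * y 0) + x 1 * y 1 + x 2 * y 2 + x 3 * y 3

/-- The space form `M_κ ⊆ ℝ⁴` (for `κ = 0, 1, -1`): the affine hyperplane `e₀ + ℝ³` for `κ = 0`,
the unit sphere for `κ = 1`, and the sheet of the hyperboloid through `e₀` for `κ = -1`. -/
def carrier (κ : ℝ) : Set E4 :=
  {x | if κ = 0 then x 0 = 1 else form κ x x = κ ∧ (κ < 0 → 0 < x 0)}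

/-- The tangent space `T_p M_κ`, as a set of vectors of `ℝ⁴`. -/
def tangent (κ : ℝ) (p : E4) : Set E4 :=
  {v | if κ = 0 then v 0 = 0 else form κ p v = 0}

/-- The norm of a tangent vector in the induced Riemannian metric. -/
def tnorm (κ : ℝ) (v : E4) : ℝ := Real.sqrt (form κ v v)

/-- The cross product on `T_p M_κ`: the tangent vector `w = u × v` with
`⟨w, x⟩_κ = det (p, u, v, x)` for all tangent `x`. If `u, v` are orthonormal, then `w` is the unit
vector for which `(p, u, v, w)` is a positively oriented orthogonal basis of `ℝ⁴`. -/
def cross (κ : ℝ) (p u v : E4) : E4 := fun i =>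
  (if i = 0 then κ else 1) * (Matrix.of ![p, u, v, Pi.single i 1]).det

/-- The covariant derivative `DX/ds` along the curve `c` of a tangent vector field `X` along `c`:
the orthogonal projection of the derivative in `ℝ⁴` onto the tangent space
(for `κ = ±1`, `⟨c, c⟩_κ = κ` and the normal space is spanned by `c`; for `κ = 0` the derivative is
already tangent). -/
def covDeriv (κ : ℝ) (c X : ℝ → E4) (s : ℝ) : E4 :=
  deriv X s - (κ * form κ (deriv X s) (c s)) • c s

/-- Parallel smooth tangent vector fields along a curve of `M_κ`. -/
structure IsParallel (κ : ℝ) (c X : ℝ → E4) : Prop where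
  smooth : ContDiff ℝ ∞ X
  mem_tangent : ∀ t, X t ∈ tangent κ (c t)
  covDeriv_eq : ∀ t, covDeriv κ c X t = 0

/-- Complete unit speed geodesics `σ : ℝ → M_κ`. -/
structure UnitGeodesic (κ : ℝ) where
  toFun : ℝ → E4
  smooth : ContDiff ℝ ∞ toFun
  mem : ∀ s, toFun s ∈ carrier κ
  unit_speed : ∀ s, form κ (deriv toFun s) (deriv toFun s) = 1
  covDeriv_eq : ∀ s, covDeriv κ toFun (deriv toFun) s = 0

instance (κ : ℝ) : CoeFun (UnitGeodesic κ) fun _ => ℝ → E4 := ⟨UnitGeodesic.toFun⟩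

/-- The velocity `σ'(s)`. -/
def UnitGeodesic.vel {κ : ℝ} (σ : UnitGeodesic κ) (s : ℝ) : E4 := deriv σ s

/-- `σ₁ ∼ σ₂` if they differ by a translation of the parameter. -/
instance geodesicSetoid (κ : ℝ) : Setoid (UnitGeodesic κ) where
  r σ₁ σ₂ := ∃ t₀ : ℝ, ∀ t, σ₁ t = σ₂ (t + t₀)
  iseqv :=
    { refl := fun _ => ⟨0, fun t => by simp⟩
      symm := fun {_ _} ⟨a, h⟩ => ⟨-a, fun t => by rw [h]; simp⟩
      trans := fun {_ _ _} ⟨a, h⟩ ⟨b, k⟩ => ⟨a + b, fun t => by rw [h, k, add_assoc]⟩ }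

/-- The space `𝒢_κ` of complete oriented geodesics of `M_κ` up to parametrization. -/
def Geod (κ : ℝ) : Type := Quotient (geodesicSetoid κ)

/-- The oriented geodesic `[σ]`. -/
def UnitGeodesic.cls {κ : ℝ} (σ : UnitGeodesic κ) : Geod κ := Quotient.mk _ σ

/-- Smooth functions on `𝒢_κ`. The differentiable structure of `𝒢_κ` as a homogeneous space of the
isometry group is the one for which the projection `(σ(0), σ'(0)) ↦ [σ]` of the unit tangent bundle
of `M_κ` (itself a homogeneous space of that group) onto `𝒢_κ` is a submersion. Hence `f` is smooth
iff its pull-back to the unit tangent bundle is, that is (the unit tangent bundle being a closed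
submanifold of `ℝ⁴ × ℝ⁴`), iff this pull-back is the restriction of a smooth function on
`ℝ⁴ × ℝ⁴`. -/
def IsSmoothFun {κ : ℝ} (f : Geod κ → ℝ) : Prop :=
  ∃ F : E4 × E4 → ℝ, ContDiff ℝ ∞ F ∧ ∀ σ : UnitGeodesic κ, f σ.cls = F (σ 0, σ.vel 0)

/-- Curves in `𝒢_κ` that are smooth on an interval around `0` (their values outside of the interval
play no role). -/
structure SmoothCurve (κ : ℝ) where
  toFun : ℝ → Geod κ
  smooth : ∃ ε > 0, ∀ f : Geod κ → ℝ, IsSmoothFun f →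
    ContDiffOn ℝ ∞ (fun t => f (toFun t)) (Set.Ioo (-ε) ε)

/-- Two smooth curves have the same initial velocity if they have the same initial point, and the
same derivative at `0` after composition with any smooth function. -/
instance velocitySetoid (κ : ℝ) : Setoid (SmoothCurve κ) where
  r c₁ c₂ := c₁.toFun 0 = c₂.toFun 0 ∧ ∀ f : Geod κ → ℝ, IsSmoothFun f →
    deriv (fun t => f (c₁.toFun t)) 0 = deriv (fun t => f (c₂.toFun t)) 0
  iseqv :=
    { refl := fun _ => ⟨rfl, fun _ _ => rfl⟩
      symm := fun {_ _} h => ⟨h.1.symm, fun f hf => (h.2 f hf).symm⟩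
      trans := fun {_ _ _} h k => ⟨h.1.trans k.1, fun f hf => (h.2 f hf).trans (k.2 f hf)⟩ }

/-- The tangent bundle `T𝒢_κ`: initial velocities of smooth curves in `𝒢_κ`. -/
def TGeod (κ : ℝ) : Type := Quotient (velocitySetoid κ)

/-- Smooth one-parameter families `φ(s, t) = φ_t(s)` of unit speed geodesics, defined for `t` in an
interval around `0` (the values for `t` outside of the interval play no role). -/
structure GeodesicFamily (κ : ℝ) where
  toFun : ℝ → UnitGeodesic κ
  smooth : ∃ ε > 0, ContDiffOn ℝ ∞ (fun q : ℝ × ℝ => toFun q.2 q.1)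
    (Set.univ ×ˢ Set.Ioo (-ε) ε)

instance (κ : ℝ) : CoeFun (GeodesicFamily κ) fun _ => ℝ → UnitGeodesic κ :=
  ⟨GeodesicFamily.toFun⟩

/-- The variation field `J(s) = d/dt|₀ φ_t(s)`. -/
def GeodesicFamily.field {κ : ℝ} (φ : GeodesicFamily κ) (s : ℝ) : E4 :=
  deriv (fun t => φ t s) 0

theorem GeodesicFamily.vel_eq {κ : ℝ} (φ : GeodesicFamily κ) {ε : ℝ}
    (h : ContDiffOn ℝ ∞ (fun q : ℝ × ℝ => φ q.2 q.1) (Set.univ ×ˢ Set.Ioo (-ε) ε))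
    (s t : ℝ) (ht : t ∈ Set.Ioo (-ε) ε) :
    (φ t).vel s = fderiv ℝ (fun q : ℝ × ℝ => φ q.2 q.1) (s, t) (1, 0) := by
  have ho : IsOpen ((Set.univ : Set ℝ) ×ˢ Set.Ioo (-ε) ε) := isOpen_univ.prod isOpen_Ioo
  have hd : DifferentiableAt ℝ (fun q : ℝ × ℝ => φ q.2 q.1) (s, t) :=
    (h.contDiffAt (ho.mem_nhds ⟨trivial, ht⟩)).differentiableAt (by simp)
  have hc : HasDerivAt (fun x : ℝ => (x, t)) ((1 : ℝ), (0 : ℝ)) s :=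
    (hasDerivAt_id s).prodMk (hasDerivAt_const s t)
  exact (hd.hasFDerivAt.comp_hasDerivAt s hc).deriv

theorem GeodesicFamily.contDiffOn_fderiv {κ : ℝ} (φ : GeodesicFamily κ) {ε : ℝ}
    (h : ContDiffOn ℝ ∞ (fun q : ℝ × ℝ => φ q.2 q.1) (Set.univ ×ˢ Set.Ioo (-ε) ε)) (s : ℝ) :
    ContDiffOn ℝ ∞ (fun t => (φ t).vel s) (Set.Ioo (-ε) ε) := by
  have ho : IsOpen ((Set.univ : Set ℝ) ×ˢ Set.Ioo (-ε) ε) := isOpen_univ.prod isOpen_Ioo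
  have h1 : ContDiffOn ℝ ∞ (fderiv ℝ (fun q : ℝ × ℝ => φ q.2 q.1))
      (Set.univ ×ˢ Set.Ioo (-ε) ε) := h.fderiv_of_isOpen ho (by simp)
  have h2 : ContDiffOn ℝ ∞ (fun t : ℝ => ((s, t) : ℝ × ℝ)) (Set.Ioo (-ε) ε) := by fun_prop
  have h3 := h1.comp h2 (fun t ht => ⟨trivial, ht⟩)
  exact (h3.clm_apply (contDiffOn_const (c := ((1 : ℝ), (0 : ℝ))))).congr
    (fun t ht => φ.vel_eq h s t ht)

theorem GeodesicFamily.contDiffOn_eval {κ : ℝ} (φ : GeodesicFamily κ) {ε : ℝ}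
    (h : ContDiffOn ℝ ∞ (fun q : ℝ × ℝ => φ q.2 q.1) (Set.univ ×ˢ Set.Ioo (-ε) ε)) (s : ℝ) :
    ContDiffOn ℝ ∞ (fun t => φ t s) (Set.Ioo (-ε) ε) :=
  h.comp (f := fun t : ℝ => ((s, t) : ℝ × ℝ)) (by fun_prop) (fun _ ht => ⟨trivial, ht⟩)

/-- The curve `t ↦ [φ_t]` in `𝒢_κ`. -/
def GeodesicFamily.curve {κ : ℝ} (φ : GeodesicFamily κ) : SmoothCurve κ where
  toFun t := (φ t).cls
  smooth := by
    obtain ⟨ε, hε, h⟩ := φ.smooth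
    refine ⟨ε, hε, ?_⟩
    rintro f ⟨F, hF, hf⟩
    simp only [hf]
    exact hF.comp_contDiffOn ((φ.contDiffOn_eval h 0).prodMk (φ.contDiffOn_fderiv h 0))

/-- The tangent vector `d/dt|₀ [φ_t]` of `𝒢_κ`. -/
def GeodesicFamily.velocity {κ : ℝ} (φ : GeodesicFamily κ) : TGeod κ := Quotient.mk _ φ.curve

/-- The set `𝒥_σ` of Jacobi fields along `σ` that arise from variations of `σ` by unit speed
geodesics. -/
def jacobiFields {κ : ℝ} (σ : UnitGeodesic κ) : Set (ℝ → E4) :=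
  {J | ∃ φ : GeodesicFamily κ, φ 0 = σ ∧ φ.field = J}

/-- The map `𝒯_σ : 𝒥_σ → T𝒢_κ`, `𝒯_σ(J) = d/dt|₀ [φ_t]`, for a variation `φ` of `σ` by unit speed
geodesics associated with `J`; any such variation gives the same result (`transfer_eq`). -/
def transfer {κ : ℝ} (σ : UnitGeodesic κ) (J : jacobiFields σ) : TGeod κ :=
  (Classical.choose J.2).velocity

theorem hasDerivAt_fderiv_apply {Φ : ℝ × ℝ → E4} {c : ℝ → ℝ × ℝ} {x : ℝ} {w : ℝ × ℝ}
    (h : ContDiffAt ℝ ∞ Φ (c x)) (hc : HasDerivAt c w x) (v : ℝ × ℝ) :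
    HasDerivAt (fun t => fderiv ℝ Φ (c t) v) (fderiv ℝ (fderiv ℝ Φ) (c x) w v) x := by
  have hdd : DifferentiableAt ℝ (fderiv ℝ Φ) (c x) :=
    (h.fderiv_right (m := 1) (by norm_cast)).differentiableAt (by simp)
  have h1 := hdd.hasFDerivAt.comp_hasDerivAt x hc
  exact (ContinuousLinearMap.apply ℝ E4 v).hasFDerivAt.comp_hasDerivAt x h1

theorem GeodesicFamily.hasDerivAt_vel {κ : ℝ} (φ : GeodesicFamily κ) (s : ℝ) :
    HasDerivAt (fun t => (φ t).vel s) (deriv φ.field s) 0 := by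
  obtain ⟨ε, hε, h⟩ := φ.smooth
  have h0 : (0 : ℝ) ∈ Set.Ioo (-ε) ε := ⟨by linarith, hε⟩
  have ho : IsOpen ((Set.univ : Set ℝ) ×ˢ Set.Ioo (-ε) ε) := isOpen_univ.prod isOpen_Ioo
  have hvel := fun t ht => φ.vel_eq h s t ht
  have hfun : φ.field = fun x => deriv ((fun q : ℝ × ℝ => φ q.2 q.1) ∘ fun t => (x, t)) 0 := rfl
  generalize (fun q : ℝ × ℝ => φ q.2 q.1) = Φ at h hvel hfun
  have hat : ∀ x, ContDiffAt ℝ ∞ Φ (x, 0) := fun x =>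
    h.contDiffAt (ho.mem_nhds ⟨trivial, h0⟩)
  have hc1 : ∀ x : ℝ, HasDerivAt (fun t : ℝ => (x, t)) ((0 : ℝ), (1 : ℝ)) 0 := fun x =>
    (hasDerivAt_const (0 : ℝ) x).prodMk (hasDerivAt_id (0 : ℝ))
  have hc2 : HasDerivAt (fun x : ℝ => (x, (0 : ℝ))) ((1 : ℝ), (0 : ℝ)) s :=
    (hasDerivAt_id s).prodMk (hasDerivAt_const s (0 : ℝ))
  have hfield : φ.field = fun x => fderiv ℝ Φ (x, 0) (0, 1) := by
    rw [hfun]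
    funext x
    exact ((((hat x).differentiableAt (by simp)).hasFDerivAt).comp_hasDerivAt (0 : ℝ)
      (hc1 x)).deriv
  have hsym : IsSymmSndFDerivAt ℝ Φ (s, 0) :=
    (hat s).isSymmSndFDerivAt (by
      rw [minSmoothness_of_isRCLikeNormedField]
      exact WithTop.coe_le_coe.2 (le_top : (2 : ℕ∞) ≤ ⊤))
  have hJ : deriv φ.field s = fderiv ℝ (fderiv ℝ Φ) (s, 0) (1, 0) (0, 1) := by
    rw [hfield]
    exact (hasDerivAt_fderiv_apply (c := fun x => (x, (0 : ℝ))) (hat s) hc2 (0, 1)).deriv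
  rw [hJ, hsym.eq (1, 0) (0, 1)]
  refine (hasDerivAt_fderiv_apply (c := fun t => (s, t)) (hat s) (hc1 s) (1, 0)).congr_of_eventuallyEq ?_
  filter_upwards [isOpen_Ioo.mem_nhds h0] with t ht
  exact hvel t ht

theorem GeodesicFamily.hasDerivAt_eval {κ : ℝ} (φ : GeodesicFamily κ) (s : ℝ) :
    HasDerivAt (fun t => φ t s) (φ.field s) 0 := by
  obtain ⟨ε, hε, h⟩ := φ.smooth
  exact (((φ.contDiffOn_eval h s).contDiffAt
    (isOpen_Ioo.mem_nhds ⟨by linarith, hε⟩)).differentiableAt (by simp)).hasDerivAt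

theorem transfer_eq {κ : ℝ} (φ : GeodesicFamily κ) {σ : UnitGeodesic κ} (h0 : φ 0 = σ)
    (J : jacobiFields σ) (hJ : φ.field = J) : transfer σ J = φ.velocity := by
  obtain ⟨h1, h2⟩ := Classical.choose_spec J.2
  set ψ := Classical.choose J.2 with hψ
  change ψ.velocity = φ.velocity
  refine Quotient.sound ⟨?_, ?_⟩
  · change (ψ 0).cls = (φ 0).cls
    rw [h0, h1]
  · rintro f ⟨F, hF, hf⟩
    have key : ∀ χ : GeodesicFamily κ, deriv (fun t => f (χ.curve.toFun t)) 0 =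
        fderiv ℝ F (χ 0 0, (χ 0).vel 0) (χ.field 0, deriv χ.field 0) := by
      intro χ
      have e : (fun t => f (χ.curve.toFun t)) = fun t => F (χ t 0, (χ t).vel 0) := by
        funext t
        exact hf (χ t)
      rw [e]
      have hd := (hF.differentiable (by simp) (χ 0 0, (χ 0).vel 0)).hasFDerivAt
      exact (hd.comp_hasDerivAt (0 : ℝ)
        ((χ.hasDerivAt_eval 0).prodMk (χ.hasDerivAt_vel 0))).deriv
    rw [key ψ, key φ, h0, h1, h2, hJ]

/-- `φ` is the `α`-helicoidal parametrized surface `φ(s, t)` with initial ray `ℓ` and axis the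
geodesic `γ` with initial velocity `A`, where `p ∈ ℓ` and `A ∈ T_p M_κ` is a unit vector orthogonal
to `ℓ`: if `ℓ = [σ]` with `σ(0) = p`, and `V`, `B` are the parallel fields along `γ` with
`V(0) = σ'(0)` and `B(0) = A × σ'(0)`, then for each `t` the curve `s ↦ φ(s, t)` is the geodesic
starting at `γ(t)` with velocity `cos(αt) V(t) + sin(αt) B(t)`. -/
def IsHelicoid {κ : ℝ} (α : ℝ) (ℓ : Geod κ) (p A : E4) (φ : GeodesicFamily κ) : Prop :=
  ∃ (σ γ : UnitGeodesic κ) (V B : ℝ → E4),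
    σ.cls = ℓ ∧ σ 0 = p ∧
    A ∈ tangent κ p ∧ form κ A A = 1 ∧ form κ A (σ.vel 0) = 0 ∧
    γ 0 = p ∧ γ.vel 0 = A ∧
    IsParallel κ γ V ∧ V 0 = σ.vel 0 ∧
    IsParallel κ γ B ∧ B 0 = cross κ p A (σ.vel 0) ∧
    ∀ t, φ t 0 = γ t ∧ (φ t).vel 0 = Real.cos (α * t) • V t + Real.sin (α * t) • B t

/-- The set `𝒜_κ^α ⊆ T𝒢_κ` of `α`-admissible tangent vectors: the initial velocities of the
`α`-helicoidal curves `t ↦ [s ↦ φ(s, t)]`. -/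
def admissible (κ α : ℝ) : Set (TGeod κ) :=
  {X | ∃ (ℓ : Geod κ) (p A : E4) (φ : GeodesicFamily κ), IsHelicoid α ℓ p A φ ∧ X = φ.velocity}

end SpaceForm

end

noncomputable section

namespace SpaceForm

variable {κ : ℝ}

/-! ### The bilinear form and the cross product -/

/-! A tangent vector of `Geod κ` is a pair (J(0), dJ/ds(0)), with dJ/ds taken in ℝ⁴, modulo
multiples of the geodesic flow direction (σ', -κσ). An α-helicoid has J(0) = A and dJ/ds(0) = αA ×
σ', with A a unit vector normal to σ (`IsHelicoid.initial`).

Sufficiency: write J(0) = A + aσ' with A ⊥ σ'. The cross product ignores aσ', the norm condition and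
α ≠ 0 give ‖A‖ = 1, and the helicoid with axis A differs from J only by a times the flow direction,
which is invisible in `Geod κ` (`GeodesicFamily.velocity_eq`, `fderiv_flow_eq_zero`).

Converse: the helicoid may be based at another point σ(t₀). With c = `cosK κ t₀` and s = `sinK κ
t₀`, its axis A is orthogonal to q = σ(0) and v = σ'(0), and E = A × v is the same vector of ℝ⁴ at
both points (`cross_rotate`). Comparing derivatives of the Plücker coordinates σ ∧ σ'
(`GeodesicFamily.plucker_eq_of_velocity_eq`, `eq_zero_of_wedge_add_wedge`) gives J'(0) = κsA + cαE
and cA - sαE for the normal part of J(0). Then J(0) ⊥ J'(0) reads cs(κ - α²) = 0. For κ ≤ 0 we have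
c > 0 and κ < α², so s = 0 and c = 1. For κ = 1 either factor c or κ - α² may vanish. -/

theorem form_comm (κ : ℝ) (x y : E4) : form κ x y = form κ y x := by
  simp only [form]; ring

theorem form_add_left (κ : ℝ) (x y z : E4) : form κ (x + y) z = form κ x z + form κ y z := by
  simp only [form, Pi.add_apply]; ring

theorem form_sub_left (κ : ℝ) (x y z : E4) : form κ (x - y) z = form κ x z - form κ y z := by
  simp only [form, Pi.sub_apply]; ring

theorem form_smul_left (κ a : ℝ) (x z : E4) : form κ (a • x) z = a * form κ x z := by
  simp only [form, Pi.smul_apply, smul_eq_mul]; ring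

theorem form_add_right (κ : ℝ) (x y z : E4) : form κ z (x + y) = form κ z x + form κ z y := by
  simp only [form, Pi.add_apply]; ring

theorem form_sub_right (κ : ℝ) (x y z : E4) : form κ z (x - y) = form κ z x - form κ z y := by
  simp only [form, Pi.sub_apply]; ring

theorem form_smul_right (κ a : ℝ) (x z : E4) : form κ z (a • x) = a * form κ z x := by
  simp only [form, Pi.smul_apply, smul_eq_mul]; ring

theorem hasDerivAt_form (κ : ℝ) {x y : ℝ → E4} {x' y' : E4} {t : ℝ}
    (hx : HasDerivAt x x' t) (hy : HasDerivAt y y' t) :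
    HasDerivAt (fun t => form κ (x t) (y t)) (form κ x' (y t) + form κ (x t) y') t := by
  have hx' := hasDerivAt_pi.1 hx
  have hy' := hasDerivAt_pi.1 hy
  refine ((((((hx' 0).mul (hy' 0)).const_mul κ).add ((hx' 1).mul (hy' 1))).add
    ((hx' 2).mul (hy' 2))).add ((hx' 3).mul (hy' 3))).congr_deriv ?_
  simp only [form]
  ring

theorem cross_eq (κ : ℝ) (p u v : E4) : cross κ p u v =
    ![-κ * (p 1 * (u 2 * v 3 - u 3 * v 2) - p 2 * (u 1 * v 3 - u 3 * v 1)
        + p 3 * (u 1 * v 2 - u 2 * v 1)),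
      p 0 * (u 2 * v 3 - u 3 * v 2) - p 2 * (u 0 * v 3 - u 3 * v 0)
        + p 3 * (u 0 * v 2 - u 2 * v 0),
      -(p 0 * (u 1 * v 3 - u 3 * v 1) - p 1 * (u 0 * v 3 - u 3 * v 0)
        + p 3 * (u 0 * v 1 - u 1 * v 0)),
      p 0 * (u 1 * v 2 - u 2 * v 1) - p 1 * (u 0 * v 2 - u 2 * v 0)
        + p 2 * (u 0 * v 1 - u 1 * v 0)] := by
  funext i
  fin_cases i <;>
    simp [cross, Matrix.det_succ_row_zero, Fin.sum_univ_succ, Fin.succAbove, Pi.single_apply] <;>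
    ring

theorem mem_tangent_zero {p v : E4} : v ∈ tangent 0 p ↔ v 0 = 0 := by simp [tangent]

theorem mem_tangent_of_ne (hκ : κ ≠ 0) {p v : E4} : v ∈ tangent κ p ↔ form κ p v = 0 := by
  simp [tangent, hκ]

theorem mem_carrier_zero {p : E4} : p ∈ carrier 0 ↔ p 0 = 1 := by simp [carrier]

theorem mem_carrier_of_ne (hκ : κ ≠ 0) {p : E4} :
    p ∈ carrier κ ↔ form κ p p = κ ∧ (κ < 0 → 0 < p 0) := by
  simp [carrier, hκ]

theorem tangent_add {p x y : E4} (hx : x ∈ tangent κ p) (hy : y ∈ tangent κ p) :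
    x + y ∈ tangent κ p := by
  by_cases h : κ = 0
  · subst h; simp_all [mem_tangent_zero]
  · simp_all [mem_tangent_of_ne, form_add_right]

theorem tangent_smul {p x : E4} (a : ℝ) (hx : x ∈ tangent κ p) : a • x ∈ tangent κ p := by
  by_cases h : κ = 0
  · subst h; simp_all [mem_tangent_zero]
  · simp_all [mem_tangent_of_ne, form_smul_right]

theorem tangent_sub {p x y : E4} (hx : x ∈ tangent κ p) (hy : y ∈ tangent κ p) :
    x - y ∈ tangent κ p := by
  by_cases h : κ = 0
  · subst h; simp_all [mem_tangent_zero]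
  · simp_all [mem_tangent_of_ne, form_sub_right]


theorem cross_mem_tangent (hκ : κ = 0 ∨ κ = 1 ∨ κ = -1) (p u v : E4) :
    cross κ p u v ∈ tangent κ p := by
  rcases hκ with rfl | rfl | rfl
  · simp [mem_tangent_zero, cross_eq]
  all_goals
    rw [mem_tangent_of_ne (by norm_num)]
    simp [form, cross_eq]
    ring

/-- Pairing with x gives det(p, u, v, x), which vanishes for a repeated row. For κ = ±1 this uses κ²
= 1; for κ = 0 the form does not see coordinate 0, so x must be tangent. -/
theorem form_cross_left (hκ : κ = 0 ∨ κ = 1 ∨ κ = -1) {p u : E4} (hu : u ∈ tangent κ p) (v : E4) :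
    form κ (cross κ p u v) u = 0 := by
  rcases hκ with rfl | rfl | rfl
  · rw [mem_tangent_zero] at hu
    simp [form, cross_eq, hu]
    ring
  all_goals
    simp [form, cross_eq]
    ring

theorem form_cross_right (hκ : κ = 0 ∨ κ = 1 ∨ κ = -1) {p v : E4} (u : E4)
    (hv : v ∈ tangent κ p) : form κ (cross κ p u v) v = 0 := by
  rcases hκ with rfl | rfl | rfl
  · rw [mem_tangent_zero] at hv
    simp [form, cross_eq, hv]
    ring
  all_goals
    simp [form, cross_eq]
    ring

theorem form_cross_self (hκ : κ = 0 ∨ κ = 1 ∨ κ = -1) {p u v : E4} (hp : p ∈ carrier κ)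
    (hu : u ∈ tangent κ p) (hv : v ∈ tangent κ p) (hvv : form κ v v = 1) (huv : form κ u v = 0) :
    form κ (cross κ p u v) (cross κ p u v) = form κ u u := by
  have key : κ ≠ 0 → κ ^ 2 = 1 → form κ (cross κ p u v) (cross κ p u v) = form κ u u := by
    intro h0 h1
    rw [mem_tangent_of_ne h0] at hu hv
    have hpp := ((mem_carrier_of_ne h0).1 hp).1
    -- Up to the factor κ, this is the Gram determinant of (p, u, v).
    have gram : form κ (cross κ p u v) (cross κ p u v) = κ *
        (form κ p p * (form κ u u * form κ v v - form κ u v ^ 2)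
        - form κ p u * (form κ p u * form κ v v - form κ u v * form κ p v)
        + form κ p v * (form κ p u * form κ u v - form κ u u * form κ p v)) := by
      obtain rfl | rfl := (show κ = 1 ∨ κ = -1 by simpa using h1) <;> simp [form, cross_eq] <;> ring
    rw [gram, hpp, hu, hv, hvv, huv]
    linear_combination form κ u u * h1
  rcases hκ with rfl | rfl | rfl
  · rw [mem_tangent_zero] at hu hv
    rw [mem_carrier_zero] at hp
    have e : form 0 (cross 0 p u v) (cross 0 p u v) =
        form 0 u u * form 0 v v - form 0 u v ^ 2 := by
      simp [form, cross_eq, hu, hv, hp]; ring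
    rw [e, hvv, huv]; ring
  · exact key (by norm_num) (by norm_num)
  · exact key (by norm_num) (by norm_num)

theorem cross_add_smul_right (κ a : ℝ) (p u v : E4) :
    cross κ p (u + a • v) v = cross κ p u v := by
  rw [cross_eq, cross_eq]
  ext i
  fin_cases i <;> simp [-mul_eq_mul_left_iff, -neg_inj] <;> ring

/-- The product depends on p and v only through p ∧ v, which is multiplied by c² + κs² = 1. Hence A
× σ' is constant in ℝ⁴ along σ for fixed A. -/
theorem cross_rotate (κ c s : ℝ) (h : c ^ 2 + κ * s ^ 2 = 1) (p u v : E4) :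
    cross κ (c • p + s • v) u (-(κ * s) • p + c • v) = cross κ p u v := by
  have e : cross κ (c • p + s • v) u (-(κ * s) • p + c • v) =
      (c ^ 2 + κ * s ^ 2) • cross κ p u v := by
    rw [cross_eq, cross_eq]
    ext i
    fin_cases i <;> simp [-mul_eq_mul_left_iff, -neg_inj] <;> ring
  rw [e, h, one_smul]

theorem tangent_of_hasDerivAt {x : ℝ → E4} {x' : E4} {t : ℝ}
    (hx : HasDerivAt x x' t) (h : ∀ t, x t ∈ carrier κ) : x' ∈ tangent κ (x t) := by
  by_cases h0 : κ = 0
  · subst h0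
    rw [mem_tangent_zero]
    have h1 : (fun t => x t 0) = fun _ => 1 := funext fun t => mem_carrier_zero.1 (h t)
    have h2 := hasDerivAt_pi.1 hx 0
    rw [h1] at h2
    exact h2.unique (hasDerivAt_const t 1)
  · rw [mem_tangent_of_ne h0]
    have h1 : (fun t => form κ (x t) (x t)) = fun _ => κ :=
      funext fun t => ((mem_carrier_of_ne h0).1 (h t)).1
    have h2 := hasDerivAt_form κ hx hx
    rw [h1] at h2
    have h3 := h2.unique (hasDerivAt_const t κ)
    rw [form_comm κ x'] at h3
    linarith

theorem form_deriv_of_unit {y : ℝ → E4} {y' : E4} {t : ℝ}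
    (hy : HasDerivAt y y' t) (h : ∀ t, form κ (y t) (y t) = 1) : form κ y' (y t) = 0 := by
  have h2 := hasDerivAt_form κ hy hy
  rw [funext h] at h2
  have h3 := h2.unique (hasDerivAt_const t (1 : ℝ))
  rw [form_comm κ (y t)] at h3
  linarith

/-- Differentiating ⟨x, y⟩ = 0 gives the normal component of y' without a second derivative of x. -/
theorem form_deriv_of_tangent (h0 : κ ≠ 0) {x y : ℝ → E4} {x' y' : E4} {t : ℝ}
    (hx : HasDerivAt x x' t) (hy : HasDerivAt y y' t) (h : ∀ t, y t ∈ tangent κ (x t)) :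
    form κ y' (x t) = -form κ x' (y t) := by
  have h1 : (fun t => form κ (x t) (y t)) = fun _ => 0 :=
    funext fun t => (mem_tangent_of_ne h0).1 (h t)
  have h2 := hasDerivAt_form κ hx hy
  rw [h1] at h2
  have h3 := h2.unique (hasDerivAt_const t (0 : ℝ))
  rw [form_comm κ (x t)] at h3
  linarith

theorem deriv_zero_of_tangent {x y : ℝ → E4} {y' : E4} {t : ℝ}
    (hy : HasDerivAt y y' t) (h : ∀ t, y t ∈ tangent 0 (x t)) : y' 0 = 0 := by
  have h1 : (fun t => y t 0) = fun _ => 0 := funext fun t => mem_tangent_zero.1 (h t)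
  have h2 := hasDerivAt_pi.1 hy 0
  rw [h1] at h2
  exact h2.unique (hasDerivAt_const t 0)

/-! ### Geodesics -/

/-- The solution of `y'' = -κ y`, `y(0) = 1`, `y'(0) = 0`, for `κ = 0, 1, -1`. -/
def cosK (κ t : ℝ) : ℝ := if κ = 0 then 1 else if κ = 1 then Real.cos t else Real.cosh t

/-- The solution of `y'' = -κ y`, `y(0) = 0`, `y'(0) = 1`, for `κ = 0, 1, -1`. -/
def sinK (κ t : ℝ) : ℝ := if κ = 0 then t else if κ = 1 then Real.sin t else Real.sinh t

theorem cosK_neg_one : cosK (-1) = Real.cosh := by funext t; norm_num [cosK]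
theorem sinK_neg_one : sinK (-1) = Real.sinh := by funext t; norm_num [sinK]
theorem cosK_one : cosK 1 = Real.cos := by funext t; norm_num [cosK]
theorem sinK_one : sinK 1 = Real.sin := by funext t; norm_num [sinK]
theorem cosK_curv_zero : cosK 0 = fun _ => 1 := by funext t; norm_num [cosK]
theorem sinK_curv_zero : sinK 0 = fun t => t := by funext t; norm_num [sinK]

theorem cosK_zero (κ : ℝ) : cosK κ 0 = 1 := by simp [cosK]
theorem sinK_zero (κ : ℝ) : sinK κ 0 = 0 := by simp [sinK]

theorem hasDerivAt_cosK (hκ : κ = 0 ∨ κ = 1 ∨ κ = -1) (t : ℝ) :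
    HasDerivAt (cosK κ) (-(κ * sinK κ t)) t := by
  rcases hκ with rfl | rfl | rfl
  · simpa [cosK_curv_zero] using hasDerivAt_const t (1 : ℝ)
  · simpa [cosK_one, sinK_one] using Real.hasDerivAt_cos t
  · simpa [cosK_neg_one, sinK_neg_one] using Real.hasDerivAt_cosh t

theorem hasDerivAt_sinK (hκ : κ = 0 ∨ κ = 1 ∨ κ = -1) (t : ℝ) :
    HasDerivAt (sinK κ) (cosK κ t) t := by
  rcases hκ with rfl | rfl | rfl
  · simpa [cosK_curv_zero, sinK_curv_zero] using hasDerivAt_id' t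
  · simpa [cosK_one, sinK_one] using Real.hasDerivAt_sin t
  · simpa [cosK_neg_one, sinK_neg_one] using Real.hasDerivAt_sinh t

theorem contDiff_cosK (hκ : κ = 0 ∨ κ = 1 ∨ κ = -1) : ContDiff ℝ ∞ (cosK κ) := by
  rcases hκ with rfl | rfl | rfl
  · rw [cosK_curv_zero]; exact contDiff_const
  · rw [cosK_one]; exact Real.contDiff_cos
  · rw [cosK_neg_one]; exact Real.contDiff_cosh

theorem contDiff_sinK (hκ : κ = 0 ∨ κ = 1 ∨ κ = -1) : ContDiff ℝ ∞ (sinK κ) := by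
  rcases hκ with rfl | rfl | rfl
  · rw [sinK_curv_zero]; exact contDiff_id
  · rw [sinK_one]; exact Real.contDiff_sin
  · rw [sinK_neg_one]; exact Real.contDiff_sinh

theorem cosK_sq_add (hκ : κ = 0 ∨ κ = 1 ∨ κ = -1) (t : ℝ) :
    cosK κ t ^ 2 + κ * sinK κ t ^ 2 = 1 := by
  rcases hκ with rfl | rfl | rfl
  · simp [cosK_curv_zero]
  · simp [cosK_one, sinK_one]
  · rw [cosK_neg_one, sinK_neg_one]; linarith [Real.cosh_sq_sub_sinh_sq t]

theorem cosK_pos (hκ : κ = 0 ∨ κ = -1) (t : ℝ) : 0 < cosK κ t := by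
  rcases hκ with rfl | rfl
  · simp [cosK_curv_zero]
  · rw [cosK_neg_one]; exact Real.cosh_pos t

theorem curv_sq (hκ : κ = 0 ∨ κ = 1 ∨ κ = -1) : κ ≠ 0 → κ ^ 2 = 1 := by
  rcases hκ with rfl | rfl | rfl <;> norm_num

namespace UnitGeodesic

theorem hasDerivAt (σ : UnitGeodesic κ) (s : ℝ) : HasDerivAt σ (σ.vel s) s :=
  (σ.smooth.differentiable (by simp) s).hasDerivAt

theorem vel_mem_tangent (σ : UnitGeodesic κ) (s : ℝ) : σ.vel s ∈ tangent κ (σ s) :=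
  tangent_of_hasDerivAt (σ.hasDerivAt s) σ.mem

/-- The acceleration is normal, and its normal component is fixed by unit speed, so the geodesic
equation becomes the linear equation σ'' = -κσ. -/
theorem hasDerivAt_vel (hκ : κ = 0 ∨ κ = 1 ∨ κ = -1) (σ : UnitGeodesic κ) (s : ℝ) :
    HasDerivAt σ.vel (-κ • σ s) s := by
  have hd : HasDerivAt σ.vel (deriv σ.vel s) s :=
    (((contDiff_infty_iff_deriv.1 σ.smooth).2).differentiable (by simp) s).hasDerivAt
  have hg := σ.covDeriv_eq s
  change deriv σ.vel s - (κ * form κ (deriv σ.vel s) (σ s)) • σ s = 0 at hg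
  rw [sub_eq_zero] at hg
  convert hd using 1
  by_cases h0 : κ = 0
  · subst h0; rw [hg]; simp
  · have h1 := form_deriv_of_tangent h0 (σ.hasDerivAt s) hd σ.vel_mem_tangent
    have h2 : form κ (σ.vel s) (σ.vel s) = 1 := σ.unit_speed s
    rw [hg, h1, h2]; simp

/-- Applying the inverse rotation to (σ, σ') yields two quantities with zero derivative; their
values at 0 are the initial data, and `cosK_sq_add` inverts the rotation. -/
theorem eq_cosK_sinK (hκ : κ = 0 ∨ κ = 1 ∨ κ = -1) (σ : UnitGeodesic κ) (t : ℝ) :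
    σ t = cosK κ t • σ 0 + sinK κ t • σ.vel 0 ∧
      σ.vel t = -(κ * sinK κ t) • σ 0 + cosK κ t • σ.vel 0 := by
  have h1 : ∀ t, HasDerivAt (fun t => cosK κ t • σ t - sinK κ t • σ.vel t) 0 t := fun t => by
    refine (((hasDerivAt_cosK hκ t).smul (σ.hasDerivAt t)).sub
      ((hasDerivAt_sinK hκ t).smul (σ.hasDerivAt_vel hκ t))).congr_deriv ?_
    module
  have h2 : ∀ t, HasDerivAt (fun t => (κ * sinK κ t) • σ t + cosK κ t • σ.vel t) 0 t := fun t => by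
    refine ((((hasDerivAt_sinK hκ t).const_mul κ).smul (σ.hasDerivAt t)).add
      ((hasDerivAt_cosK hκ t).smul (σ.hasDerivAt_vel hκ t))).congr_deriv ?_
    module
  have e1 := is_const_of_deriv_eq_zero (fun t => (h1 t).differentiableAt) (fun t => (h1 t).deriv) t 0
  have e2 := is_const_of_deriv_eq_zero (fun t => (h2 t).differentiableAt) (fun t => (h2 t).deriv) t 0
  simp only [cosK_zero, sinK_zero, one_smul, zero_smul, mul_zero, sub_zero, zero_add] at e1 e2
  have h := cosK_sq_add hκ t
  rw [← e1, ← e2]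
  constructor
  · calc σ t = (cosK κ t ^ 2 + κ * sinK κ t ^ 2) • σ t := by rw [h, one_smul]
      _ = _ := by module
  · calc σ.vel t = (cosK κ t ^ 2 + κ * sinK κ t ^ 2) • σ.vel t := by rw [h, one_smul]
      _ = _ := by module

theorem ext_initial (hκ : κ = 0 ∨ κ = 1 ∨ κ = -1) {σ τ : UnitGeodesic κ} (h0 : σ 0 = τ 0)
    (h1 : σ.vel 0 = τ.vel 0) (t : ℝ) : σ t = τ t := by
  rw [(σ.eq_cosK_sinK hκ t).1, (τ.eq_cosK_sinK hκ t).1, h0, h1]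

end UnitGeodesic

/-- Cauchy–Schwarz on the spatial parts gives v₀² ≤ p₀² - 1. Together with |sinh| < cosh it keeps
geodesics on the upper sheet. -/
theorem abs_time_lt {p v : E4} (hp : p ∈ carrier (-1)) (hv : v ∈ tangent (-1) p)
    (hvv : form (-1) v v = 1) : |v 0| < p 0 := by
  obtain ⟨hpp, hpos⟩ := (mem_carrier_of_ne (by norm_num)).1 hp
  have hpos := hpos (by norm_num)
  rw [mem_tangent_of_ne (by norm_num)] at hv
  simp only [form] at hpp hv hvv
  rw [← abs_of_pos hpos, ← sq_lt_sq]
  have e : v 0 * p 0 = p 1 * v 1 + p 2 * v 2 + p 3 * v 3 := by linarith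
  have a : p 1 ^ 2 + p 2 ^ 2 + p 3 ^ 2 = p 0 ^ 2 - 1 := by linarith
  have b : v 1 ^ 2 + v 2 ^ 2 + v 3 ^ 2 = v 0 ^ 2 + 1 := by linarith
  have cs : (p 1 * v 1 + p 2 * v 2 + p 3 * v 3) ^ 2 ≤
      (p 1 ^ 2 + p 2 ^ 2 + p 3 ^ 2) * (v 1 ^ 2 + v 2 ^ 2 + v 3 ^ 2) := by
    nlinarith [sq_nonneg (p 1 * v 2 - p 2 * v 1), sq_nonneg (p 1 * v 3 - p 3 * v 1),
      sq_nonneg (p 2 * v 3 - p 3 * v 2)]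
  rw [← e, a, b] at cs
  nlinarith

theorem cosK_sinK_mem (hκ : κ = 0 ∨ κ = 1 ∨ κ = -1) {p v : E4} (hp : p ∈ carrier κ)
    (hv : v ∈ tangent κ p) (hvv : form κ v v = 1) (s : ℝ) :
    cosK κ s • p + sinK κ s • v ∈ carrier κ := by
  have hcs := cosK_sq_add hκ s
  have key : κ ≠ 0 → form κ (cosK κ s • p + sinK κ s • v) (cosK κ s • p + sinK κ s • v) = κ := by
    intro h0
    have hpp := ((mem_carrier_of_ne h0).1 hp).1
    have hpv := (mem_tangent_of_ne h0).1 hv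
    simp only [form_add_left, form_add_right, form_smul_left, form_smul_right, form_comm κ v p,
      hpp, hpv, hvv]
    linear_combination κ * hcs -
      sinK κ s ^ 2 * (curv_sq hκ h0)
  rcases hκ with rfl | rfl | rfl
  · rw [mem_carrier_zero] at *
    rw [mem_tangent_zero] at hv
    simp [cosK_curv_zero, hp, hv]
  · exact (mem_carrier_of_ne (by norm_num)).2 ⟨key (by norm_num), fun h => by norm_num at h⟩
  · refine (mem_carrier_of_ne (by norm_num)).2 ⟨key (by norm_num), fun _ => ?_⟩
    have h1 := abs_time_lt hp hv hvv
    have h2 : |Real.sinh s| < Real.cosh s := by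
      rw [← abs_of_pos (Real.cosh_pos s), ← sq_lt_sq]
      linarith [Real.cosh_sq_sub_sinh_sq s]
    have h3 : |Real.sinh s * v 0| < Real.cosh s * p 0 := by
      rw [abs_mul]
      exact mul_lt_mul'' h2 h1 (abs_nonneg _) (abs_nonneg _)
    simp only [cosK_neg_one, sinK_neg_one, Pi.add_apply, Pi.smul_apply, smul_eq_mul]
    linarith [(abs_lt.1 h3).1]

theorem hasDerivAt_cosK_sinK (hκ : κ = 0 ∨ κ = 1 ∨ κ = -1) (p v : E4) (s : ℝ) :
    HasDerivAt (fun s => cosK κ s • p + sinK κ s • v) (-(κ * sinK κ s) • p + cosK κ s • v) s :=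
  ((hasDerivAt_cosK hκ s).smul_const p).add ((hasDerivAt_sinK hκ s).smul_const v)

theorem hasDerivAt_cosK_sinK' (hκ : κ = 0 ∨ κ = 1 ∨ κ = -1) (p v : E4) (s : ℝ) :
    HasDerivAt (fun s => -(κ * sinK κ s) • p + cosK κ s • v)
      (-κ • (cosK κ s • p + sinK κ s • v)) s := by
  refine (((((hasDerivAt_sinK hκ s).const_mul κ).neg).smul_const p).add
    ((hasDerivAt_cosK hκ s).smul_const v)).congr_deriv ?_
  module

/-- The unit speed geodesic with given initial point and velocity. -/
def geodesic (hκ : κ = 0 ∨ κ = 1 ∨ κ = -1) (p v : E4) (hp : p ∈ carrier κ)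
    (hv : v ∈ tangent κ p) (hvv : form κ v v = 1) : UnitGeodesic κ where
  toFun s := cosK κ s • p + sinK κ s • v
  smooth := ((contDiff_cosK hκ).smul contDiff_const).add ((contDiff_sinK hκ).smul contDiff_const)
  mem := cosK_sinK_mem hκ hp hv hvv
  unit_speed s := by
    rw [(hasDerivAt_cosK_sinK hκ p v s).deriv]
    have hcs := cosK_sq_add hκ s
    by_cases h0 : κ = 0
    · subst h0
      simp [cosK_curv_zero, hvv]
    · have hpp := ((mem_carrier_of_ne h0).1 hp).1
      have hpv := (mem_tangent_of_ne h0).1 hv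
      simp only [form_add_left, form_add_right, form_smul_left, form_smul_right, form_comm κ v p,
        hpp, hpv, hvv]
      linear_combination hcs + κ * sinK κ s ^ 2 * curv_sq hκ h0
  covDeriv_eq s := by
    have hd : deriv (fun s => cosK κ s • p + sinK κ s • v) =
        fun s => -(κ * sinK κ s) • p + cosK κ s • v :=
      funext fun s => (hasDerivAt_cosK_sinK hκ p v s).deriv
    rw [covDeriv, hd, (hasDerivAt_cosK_sinK' hκ p v s).deriv]
    by_cases h0 : κ = 0
    · subst h0; simp
    · rw [form_smul_left, ((mem_carrier_of_ne h0).1 (cosK_sinK_mem hκ hp hv hvv s)).1]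
      have e : κ * (-κ * κ) = -κ := by linear_combination -κ * curv_sq hκ h0
      rw [e, sub_self]

theorem geodesic_zero (hκ : κ = 0 ∨ κ = 1 ∨ κ = -1) (p v : E4) (hp : p ∈ carrier κ)
    (hv : v ∈ tangent κ p) (hvv : form κ v v = 1) : geodesic hκ p v hp hv hvv 0 = p := by
  simp [geodesic, cosK_zero, sinK_zero]

theorem geodesic_vel_zero (hκ : κ = 0 ∨ κ = 1 ∨ κ = -1) (p v : E4) (hp : p ∈ carrier κ)
    (hv : v ∈ tangent κ p) (hvv : form κ v v = 1) : (geodesic hκ p v hp hv hvv).vel 0 = v := by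
  refine (hasDerivAt_cosK_sinK hκ p v 0).deriv.trans ?_
  simp [cosK_zero, sinK_zero]

/-! ### Initial data of variations -/

theorem GeodesicFamily.deriv_comp_curve (φ : GeodesicFamily κ) {f : Geod κ → ℝ}
    {F : E4 × E4 → ℝ} (hF : ContDiff ℝ ∞ F)
    (hf : ∀ σ : UnitGeodesic κ, f σ.cls = F (σ 0, σ.vel 0)) :
    deriv (fun t => f (φ.curve.toFun t)) 0 =
      fderiv ℝ F (φ 0 0, (φ 0).vel 0) (φ.field 0, deriv φ.field 0) := by
  have e : (fun t => f (φ.curve.toFun t)) = fun t => F (φ t 0, (φ t).vel 0) :=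
    funext fun t => hf (φ t)
  rw [e]
  have hd := (hF.differentiable (by simp) (φ 0 0, (φ 0).vel 0)).hasFDerivAt
  exact (hd.comp_hasDerivAt (0 : ℝ) ((φ.hasDerivAt_eval 0).prodMk (φ.hasDerivAt_vel 0))).deriv

theorem UnitGeodesic.cls_eq_iff {σ τ : UnitGeodesic κ} :
    σ.cls = τ.cls ↔ ∃ t₀ : ℝ, ∀ t, σ t = τ (t + t₀) :=
  ⟨fun h => Quotient.exact h, fun h => Quotient.sound h⟩

theorem UnitGeodesic.vel_of_shift {σ τ : UnitGeodesic κ} {t₀ : ℝ}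
    (h : ∀ t, σ t = τ (t + t₀)) (t : ℝ) : σ.vel t = τ.vel (t + t₀) := by
  have e : (σ : ℝ → E4) = fun t => τ (t + t₀) := funext h
  unfold UnitGeodesic.vel
  rw [e, deriv_comp_add_const]

/-- Smooth functions on `𝒢_κ` are invariant under the geodesic flow. -/
theorem fderiv_flow_eq_zero (hκ : κ = 0 ∨ κ = 1 ∨ κ = -1) (σ : UnitGeodesic κ)
    {f : Geod κ → ℝ} {F : E4 × E4 → ℝ} (hF : ContDiff ℝ ∞ F)
    (hf : ∀ σ : UnitGeodesic κ, f σ.cls = F (σ 0, σ.vel 0)) :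
    fderiv ℝ F (σ 0, σ.vel 0) (σ.vel 0, -κ • σ 0) = 0 := by
  -- Restarting σ at time t gives the same class in `Geod κ`, so F is constant along the flow line;
  -- its derivative at 0 is the claim.
  have hconst : ∀ t, F (σ t, σ.vel t) = f σ.cls := fun t => by
    let τ : UnitGeodesic κ := geodesic hκ (σ t) (σ.vel t) (σ.mem t) (σ.vel_mem_tangent t)
      (σ.unit_speed t)
    have hτ0 : τ 0 = σ t := geodesic_zero hκ _ _ _ _ _
    have hτ1 : τ.vel 0 = σ.vel t := geodesic_vel_zero hκ _ _ _ _ _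
    rw [← hτ0, ← hτ1, ← hf]
    congr 1
    refine UnitGeodesic.cls_eq_iff.2 ⟨t, fun s => ?_⟩
    let ρ : UnitGeodesic κ :=
      { toFun := fun s => σ (s + t)
        smooth := σ.smooth.comp (contDiff_id.add contDiff_const)
        mem := fun s => σ.mem _
        unit_speed := fun s => by
          simp only [deriv_comp_add_const]
          exact σ.unit_speed _
        covDeriv_eq := fun s => by
          have h := σ.covDeriv_eq (s + t)
          have e : deriv (fun s => σ (s + t)) = fun s => deriv σ (s + t) :=
            funext fun s => deriv_comp_add_const _ _ _
          simp only [covDeriv, e, deriv_comp_add_const] at h ⊢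
          exact h }
    have hρ : ∀ s, ρ s = σ (s + t) := fun _ => rfl
    rw [← hρ]
    refine UnitGeodesic.ext_initial hκ ?_ ?_ s
    · rw [hτ0, hρ, zero_add]
    · rw [hτ1, UnitGeodesic.vel_of_shift hρ, zero_add]
  have hd := (hF.differentiable (by simp) (σ 0, σ.vel 0)).hasFDerivAt
  have h := hd.comp_hasDerivAt (0 : ℝ) ((σ.hasDerivAt 0).prodMk (σ.hasDerivAt_vel hκ 0))
  have e : (F ∘ fun t => (σ t, σ.vel t)) = fun _ => f σ.cls := funext hconst
  rw [e] at h
  exact h.unique (hasDerivAt_const _ _)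

theorem GeodesicFamily.field_mem_tangent (φ : GeodesicFamily κ) (s : ℝ) :
    φ.field s ∈ tangent κ (φ 0 s) :=
  tangent_of_hasDerivAt (x := fun t => φ t s) (φ.hasDerivAt_eval s) fun t => (φ t).mem s

theorem GeodesicFamily.form_deriv_field_vel (φ : GeodesicFamily κ) (s : ℝ) :
    form κ (deriv φ.field s) ((φ 0).vel s) = 0 :=
  form_deriv_of_unit (y := fun t => (φ t).vel s) (φ.hasDerivAt_vel s) fun t => (φ t).unit_speed s

/-- The velocities stay tangent along the transverse curve t ↦ φ_t(s), which determines the normal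
part of dJ/ds. The term -κ⟨J, σ'⟩σ is exactly the second component of the flow direction scaled by
⟨J, σ'⟩. -/
theorem GeodesicFamily.deriv_field_eq (φ : GeodesicFamily κ) (s : ℝ) :
    deriv φ.field s = covDeriv κ (φ 0) φ.field s -
      (κ * form κ (φ.field s) ((φ 0).vel s)) • φ 0 s := by
  rw [covDeriv]
  by_cases h0 : κ = 0
  · subst h0; simp
  · rw [form_deriv_of_tangent h0 (φ.hasDerivAt_eval s) (φ.hasDerivAt_vel s)
      fun t => (φ t).vel_mem_tangent s]
    module

theorem GeodesicFamily.covDeriv_field_mem_tangent (hκ : κ = 0 ∨ κ = 1 ∨ κ = -1)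
    (φ : GeodesicFamily κ) (s : ℝ) : covDeriv κ (φ 0) φ.field s ∈ tangent κ (φ 0 s) := by
  by_cases h0 : κ = 0
  · subst h0
    have h := deriv_zero_of_tangent (φ.hasDerivAt_vel s) fun t => (φ t).vel_mem_tangent s
    simpa [mem_tangent_zero, covDeriv] using h
  · rw [mem_tangent_of_ne h0, covDeriv, form_sub_right, form_smul_right,
      ((mem_carrier_of_ne h0).1 ((φ 0).mem s)).1, form_comm κ (φ 0 s)]
    linear_combination -form κ (deriv φ.field s) (φ 0 s) * curv_sq hκ h0

theorem GeodesicFamily.form_covDeriv_field_vel (φ : GeodesicFamily κ) (s : ℝ) :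
    form κ (covDeriv κ (φ 0) φ.field s) ((φ 0).vel s) = 0 := by
  rw [covDeriv, form_sub_left, φ.form_deriv_field_vel, form_smul_left]
  by_cases h0 : κ = 0
  · subst h0; simp
  · rw [(mem_tangent_of_ne h0).1 ((φ 0).vel_mem_tangent s)]; simp

/-- Two variations of `σ` whose variation fields differ, to first order at `0`, by a constant
multiple of the velocity have the same velocity in `𝒢_κ`. -/
theorem GeodesicFamily.velocity_eq (hκ : κ = 0 ∨ κ = 1 ∨ κ = -1) {φ ψ : GeodesicFamily κ}
    (h0 : φ 0 0 = ψ 0 0) (h1 : (φ 0).vel 0 = (ψ 0).vel 0) {a : ℝ}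
    (hJ : φ.field 0 = ψ.field 0 + a • (φ 0).vel 0)
    (hJ' : deriv φ.field 0 = deriv ψ.field 0 + a • -κ • φ 0 0) : φ.velocity = ψ.velocity := by
  refine Quotient.sound ⟨?_, ?_⟩
  · refine UnitGeodesic.cls_eq_iff.2 ⟨0, fun t => ?_⟩
    rw [add_zero]
    exact UnitGeodesic.ext_initial hκ h0 h1 t
  · rintro f ⟨F, hF, hf⟩
    rw [φ.deriv_comp_curve hF hf, ψ.deriv_comp_curve hF hf, ← h0, ← h1, hJ, hJ']
    have e : (ψ.field 0 + a • (φ 0).vel 0, deriv ψ.field 0 + a • -κ • φ 0 0) =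
        (ψ.field 0, deriv ψ.field 0) + a • ((φ 0).vel 0, -κ • φ 0 0) := rfl
    rw [e, map_add, map_smul, fderiv_flow_eq_zero hκ (φ 0) hF hf, smul_zero, add_zero]

/-! ### Helicoids -/

theorem IsParallel.hasDerivAt_zero {γ : UnitGeodesic κ} {V : ℝ → E4} (h : IsParallel κ γ V)
    (hV : form κ (γ.vel 0) (V 0) = 0) : HasDerivAt V 0 0 := by
  have hd := (h.smooth.differentiable (by simp) 0).hasDerivAt
  have hc := h.covDeriv_eq 0
  rw [covDeriv, sub_eq_zero] at hc
  suffices h1 : deriv V 0 = 0 by rwa [h1] at hd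
  rw [hc]
  by_cases h0 : κ = 0
  · subst h0; simp
  · rw [form_deriv_of_tangent h0 (γ.hasDerivAt 0) hd h.mem_tangent, hV]; simp

theorem IsHelicoid.initial (hκ : κ = 0 ∨ κ = 1 ∨ κ = -1) {α : ℝ} {ℓ : Geod κ} {p A : E4}
    {φ : GeodesicFamily κ} (h : IsHelicoid α ℓ p A φ) :
    φ 0 0 = p ∧ A ∈ tangent κ p ∧ form κ A A = 1 ∧ form κ A ((φ 0).vel 0) = 0 ∧
      φ.field 0 = A ∧ deriv φ.field 0 = α • cross κ p A ((φ 0).vel 0) := by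
  obtain ⟨σ, γ, V, B, -, -, hA, hAA, hAv, hγ, hγA, hV, hV0, hB, hB0, hφ⟩ := h
  have hvel : (φ 0).vel 0 = σ.vel 0 := by rw [(hφ 0).2]; simp [hV0]
  refine ⟨by rw [(hφ 0).1, hγ], hA, hAA, by rw [hvel, hAv], ?_, ?_⟩
  · have e : (fun t => φ t 0) = γ := funext fun t => (hφ t).1
    have h1 := φ.hasDerivAt_eval 0
    rw [e] at h1
    rw [h1.unique (γ.hasDerivAt 0), hγA]
  · have hV' := hV.hasDerivAt_zero (by rw [hγA, hV0, hAv])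
    have hB' := hB.hasDerivAt_zero (by rw [hγA, hB0, form_comm, form_cross_left hκ hA])
    have hc : HasDerivAt (fun t => Real.cos (α * t)) 0 0 := by
      simpa using ((hasDerivAt_id' (0 : ℝ)).const_mul α).cos
    have hs : HasDerivAt (fun t => Real.sin (α * t)) α 0 := by
      simpa using ((hasDerivAt_id' (0 : ℝ)).const_mul α).sin
    have e : (fun t => (φ t).vel 0) = fun t => Real.cos (α * t) • V t + Real.sin (α * t) • B t :=
      funext fun t => (hφ t).2
    have h1 := φ.hasDerivAt_vel 0
    rw [e] at h1
    rw [h1.unique ((hc.smul hV').add (hs.smul hB')), hvel, hB0]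
    simp

theorem mem_tangent_cosK_sinK {p A X : E4} (hX : X ∈ tangent κ p) (hAX : form κ A X = 0) (t : ℝ) :
    X ∈ tangent κ (cosK κ t • p + sinK κ t • A) := by
  by_cases h0 : κ = 0
  · subst h0; exact mem_tangent_zero.2 (mem_tangent_zero.1 hX)
  · rw [mem_tangent_of_ne h0] at *
    rw [form_add_left, form_smul_left, form_smul_left, hX, hAX]; simp

/-- A vector orthogonal to both p and A (for κ = 0, spatial and orthogonal to A) stays tangent along
the geodesic they span, so the parallel fields V, B of a helicoid are constant in ℝ⁴. -/
theorem isParallel_const {p A X : E4} (hX : X ∈ tangent κ p) (hAX : form κ A X = 0) :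
    IsParallel κ (fun t => cosK κ t • p + sinK κ t • A) fun _ => X where
  smooth := contDiff_const
  mem_tangent := mem_tangent_cosK_sinK hX hAX
  covDeriv_eq t := by simp [covDeriv, form]

theorem exists_isHelicoid (hκ : κ = 0 ∨ κ = 1 ∨ κ = -1) (α : ℝ) (σ : UnitGeodesic κ) {A : E4}
    (hA : A ∈ tangent κ (σ 0)) (hAA : form κ A A = 1) (hAv : form κ A (σ.vel 0) = 0) :
    ∃ φ : GeodesicFamily κ, IsHelicoid α σ.cls (σ 0) A φ ∧ φ 0 0 = σ 0 ∧
      (φ 0).vel 0 = σ.vel 0 := by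
  have hv := σ.vel_mem_tangent 0
  have hvv : form κ (σ.vel 0) (σ.vel 0) = 1 := σ.unit_speed 0
  set p := σ 0
  set v := σ.vel 0
  set B := cross κ p A v with hB
  have hBt : B ∈ tangent κ p := cross_mem_tangent hκ p A v
  have hAB : form κ A B = 0 := by rw [form_comm]; exact form_cross_left hκ hA v
  have hBv : form κ B v = 0 := form_cross_right hκ A hv
  have hBB : form κ B B = 1 := by rw [form_cross_self hκ (σ.mem 0) hA hv hvv hAv, hAA]
  have hW : ∀ t, Real.cos (α * t) • v + Real.sin (α * t) • B ∈
      tangent κ (cosK κ t • p + sinK κ t • A) := fun t =>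
    tangent_add (tangent_smul _ (mem_tangent_cosK_sinK hv hAv t))
      (tangent_smul _ (mem_tangent_cosK_sinK hBt hAB t))
  have hWW : ∀ t, form κ (Real.cos (α * t) • v + Real.sin (α * t) • B)
      (Real.cos (α * t) • v + Real.sin (α * t) • B) = 1 := fun t => by
    simp only [form_add_left, form_add_right, form_smul_left, form_smul_right, form_comm κ v B,
      hBv, hvv, hBB]
    linear_combination Real.cos_sq_add_sin_sq (α * t)
  let φ : GeodesicFamily κ :=
    { toFun := fun t => geodesic hκ _ _ (cosK_sinK_mem hκ (σ.mem 0) hA hAA t) (hW t) (hWW t)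
      smooth := by
        -- The family is smooth for all t; the radius 1 is arbitrary.
        refine ⟨1, one_pos, ContDiff.contDiffOn ?_⟩
        have c1 := (contDiff_cosK hκ).comp (contDiff_fst (E := ℝ) (F := ℝ))
        have s1 := (contDiff_sinK hκ).comp (contDiff_fst (E := ℝ) (F := ℝ))
        have c2 := (contDiff_cosK hκ).comp (contDiff_snd (E := ℝ) (F := ℝ))
        have s2 := (contDiff_sinK hκ).comp (contDiff_snd (E := ℝ) (F := ℝ))
        have c3 : ContDiff ℝ ∞ fun q : ℝ × ℝ => Real.cos (α * q.2) := by fun_prop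
        have s3 : ContDiff ℝ ∞ fun q : ℝ × ℝ => Real.sin (α * q.2) := by fun_prop
        exact (c1.smul ((c2.smul contDiff_const).add (s2.smul contDiff_const))).add
          (s1.smul ((c3.smul contDiff_const).add (s3.smul contDiff_const))) }
  have hφ0 : ∀ t, φ t 0 = cosK κ t • p + sinK κ t • A := fun t => geodesic_zero hκ _ _
    (cosK_sinK_mem hκ (σ.mem 0) hA hAA t) (hW t) (hWW t)
  have hφ1 : ∀ t, (φ t).vel 0 = Real.cos (α * t) • v + Real.sin (α * t) • B := fun t =>
    geodesic_vel_zero hκ _ _ (cosK_sinK_mem hκ (σ.mem 0) hA hAA t) (hW t) (hWW t)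
  refine ⟨φ, ⟨σ, geodesic hκ p A (σ.mem 0) hA hAA, fun _ => v, fun _ => B, rfl, rfl, hA, hAA, hAv,
    geodesic_zero hκ _ _ _ _ _, geodesic_vel_zero hκ _ _ _ _ _, isParallel_const hv hAv, rfl,
    isParallel_const hBt hAB, rfl, fun t => ⟨hφ0 t, hφ1 t⟩⟩, ?_, ?_⟩
  · rw [hφ0]; simp [cosK_zero, sinK_zero]
  · rw [hφ1]; simp

/-! ### Plücker coordinates on the space of geodesics -/

/-- These are the entries of σ ∧ σ'. Translating the parameter acts on (σ, σ') by a matrix of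
determinant `cosK`² + κ `sinK`² = 1, so they descend to the quotient and serve as smooth test
functions there. -/
theorem exists_plucker (hκ : κ = 0 ∨ κ = 1 ∨ κ = -1) (i j : Fin 4) :
    ∃ f : Geod κ → ℝ, ∀ σ : UnitGeodesic κ,
      f σ.cls = σ 0 i * σ.vel 0 j - σ 0 j * σ.vel 0 i := by
  refine ⟨Quotient.lift (fun σ => σ 0 i * σ.vel 0 j - σ 0 j * σ.vel 0 i) ?_, fun σ => rfl⟩
  rintro σ τ ⟨t₀, h⟩
  have hp := h 0
  have hv := UnitGeodesic.vel_of_shift h 0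
  rw [zero_add] at hp hv
  have hc := cosK_sq_add hκ t₀
  rw [hp, hv, (τ.eq_cosK_sinK hκ t₀).1, (τ.eq_cosK_sinK hκ t₀).2]
  simp only [Pi.add_apply, Pi.smul_apply, smul_eq_mul]
  linear_combination (τ 0 i * τ.vel 0 j - τ 0 j * τ.vel 0 i) * hc

theorem GeodesicFamily.plucker_eq_of_velocity_eq (hκ : κ = 0 ∨ κ = 1 ∨ κ = -1)
    {φ ψ : GeodesicFamily κ} (h : φ.velocity = ψ.velocity) (i j : Fin 4) :
    φ.field 0 i * (φ 0).vel 0 j + φ 0 0 i * deriv φ.field 0 j -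
      (φ.field 0 j * (φ 0).vel 0 i + φ 0 0 j * deriv φ.field 0 i) =
    ψ.field 0 i * (ψ 0).vel 0 j + ψ 0 0 i * deriv ψ.field 0 j -
      (ψ.field 0 j * (ψ 0).vel 0 i + ψ 0 0 j * deriv ψ.field 0 i) := by
  obtain ⟨f, hf⟩ := exists_plucker hκ i j
  have hs : IsSmoothFun f := by
    refine ⟨fun q => q.1 i * q.2 j - q.1 j * q.2 i, ?_, hf⟩
    fun_prop
  have key : ∀ χ : GeodesicFamily κ, deriv (fun t => f (χ.curve.toFun t)) 0 =
      χ.field 0 i * (χ 0).vel 0 j + χ 0 0 i * deriv χ.field 0 j -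
      (χ.field 0 j * (χ 0).vel 0 i + χ 0 0 j * deriv χ.field 0 i) := fun χ => by
    have e : (fun t => f (χ.curve.toFun t)) =
        fun t => χ t 0 i * (χ t).vel 0 j - χ t 0 j * (χ t).vel 0 i := funext fun t => hf (χ t)
    have h0 := hasDerivAt_pi.1 (χ.hasDerivAt_eval 0)
    have h1 := hasDerivAt_pi.1 (χ.hasDerivAt_vel 0)
    rw [e]
    exact (((h0 i).mul (h1 j)).sub ((h0 j).mul (h1 i))).deriv
  rw [← key, ← key]
  exact (Quotient.exact h).2 f hs

/-- The hypothesis is q ∧ X + Y ∧ v = 0. Contracting with q kills all terms but ⟨q, q⟩X; contracting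
the remaining Y ∧ v with v then kills Y. -/
theorem eq_zero_of_wedge_add_wedge {q v X Y : E4} (hq : q ∈ carrier κ) (hv : v ∈ tangent κ q)
    (hvv : form κ v v = 1) (hX : X ∈ tangent κ q) (hXv : form κ X v = 0) (hY : Y ∈ tangent κ q)
    (hYv : form κ Y v = 0)
    (h : ∀ i j, q i * X j - q j * X i + (Y i * v j - Y j * v i) = 0) : X = 0 ∧ Y = 0 := by
  have hX0 : X = 0 := by
    by_cases h0 : κ = 0
    · subst h0
      rw [mem_tangent_zero] at hX hY hv
      rw [mem_carrier_zero] at hq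
      -- For κ = 0 the form does not detect q₀, so the contraction is replaced by row 0, where q₀ =
      -- 1 and the other vectors vanish.
      funext j
      have := h 0 j
      rw [hX, hY, hv, hq] at this
      simpa using this
    · rw [mem_tangent_of_ne h0] at hX hY hv
      funext j
      have hqq := ((mem_carrier_of_ne h0).1 hq).1
      have e : form κ q q * X j = 0 := by
        have e1 : form κ q q * X j = q j * form κ q X - form κ q Y * v j + Y j * form κ q v := by
          simp only [form]
          linear_combination κ * q 0 * h 0 j + q 1 * h 1 j + q 2 * h 2 j + q 3 * h 3 j
        rw [e1, hX, hY, hv]; ring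
      rw [hqq] at e
      simpa [h0] using e
  refine ⟨hX0, ?_⟩
  subst hX0
  funext j
  have e : form κ v v * Y j = 0 := by
    have e1 : form κ v v * Y j = form κ Y v * v j := by
      simp only [form]
      simp only [Pi.zero_apply, mul_zero, sub_zero, zero_add] at h
      linear_combination -(κ * v 0 * h 0 j + v 1 * h 1 j + v 2 * h 2 j + v 3 * h 3 j)
    rw [e1, hYv, zero_mul]
  simpa [hvv] using e

/-! ### Characterization of admissible vectors -/

theorem transfer_mem_admissible (hκ : κ = 0 ∨ κ = 1 ∨ κ = -1) {α : ℝ} (hα : α ≠ 0)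
    (σ : UnitGeodesic κ) (J : jacobiFields σ)
    (hn : tnorm κ (covDeriv κ σ J.1 0) = |α|)
    (hc : covDeriv κ σ J.1 0 = α • cross κ (σ 0) (J.1 0) (σ.vel 0)) :
    transfer σ J ∈ admissible κ α := by
  obtain ⟨φ, rfl, hJ⟩ := J.2
  rw [transfer_eq φ rfl J hJ]
  rw [← hJ] at hn hc
  have hv := (φ 0).vel_mem_tangent 0
  have hvv : form κ ((φ 0).vel 0) ((φ 0).vel 0) = 1 := (φ 0).unit_speed 0
  have hj := φ.field_mem_tangent 0
  have hd := φ.deriv_field_eq 0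
  set a := form κ (φ.field 0) ((φ 0).vel 0) with ha
  set A := φ.field 0 - a • (φ 0).vel 0 with hA
  have hAt : A ∈ tangent κ (φ 0 0) := tangent_sub hj (tangent_smul _ hv)
  have hAv : form κ A ((φ 0).vel 0) = 0 := by
    rw [hA, form_sub_left, form_smul_left, hvv, ← ha]; ring
  have hjA : φ.field 0 = A + a • (φ 0).vel 0 := by rw [hA]; abel
  rw [hjA, cross_add_smul_right] at hc
  have hAA : form κ A A = 1 := by
    have h1 : form κ (covDeriv κ (φ 0) φ.field 0) (covDeriv κ (φ 0) φ.field 0) =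
        α ^ 2 * form κ A A := by
      rw [hc, form_smul_left, form_smul_right, form_cross_self hκ ((φ 0).mem 0) hAt hv hvv hAv]
      ring
    rw [tnorm, h1, Real.sqrt_eq_iff_mul_self_eq_of_pos (abs_pos.2 hα), abs_mul_abs_self] at hn
    have h2 : α ^ 2 * (form κ A A - 1) = 0 := by linarith
    have := (mul_eq_zero.1 h2).resolve_left (pow_ne_zero 2 hα)
    linarith
  obtain ⟨ψ, hψ, hψ0, hψ1⟩ := exists_isHelicoid hκ α (φ 0) hAt hAA hAv
  obtain ⟨-, -, -, -, hψA, hψd⟩ := hψ.initial hκ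
  -- The initial data of φ and ψ differ by a times the flow direction, a being the tangential
  -- component of J(0).
  refine ⟨_, _, _, ψ, hψ, GeodesicFamily.velocity_eq hκ hψ0.symm hψ1.symm (a := a) ?_ ?_⟩
  · rw [hψA, hjA]
  · rw [hψd, hψ1, hd, hc]; module

theorem of_transfer_mem_admissible (hκ : κ = 0 ∨ κ = -1) {α : ℝ} (hα : α ≠ 0)
    (σ : UnitGeodesic κ) (J : jacobiFields σ)
    (hJ0 : form κ (J.1 0) (covDeriv κ σ J.1 0) = 0) (h : transfer σ J ∈ admissible κ α) :
    tnorm κ (covDeriv κ σ J.1 0) = |α| ∧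
      covDeriv κ σ J.1 0 = α • cross κ (σ 0) (J.1 0) (σ.vel 0) := by
  have hκ' : κ = 0 ∨ κ = 1 ∨ κ = -1 := by tauto
  obtain ⟨φ, rfl, hJ⟩ := J.2
  rw [transfer_eq φ rfl J hJ] at h
  rw [← hJ] at hJ0 ⊢
  clear hJ
  obtain ⟨ℓ, p, A, ψ, hψ, hvel⟩ := h
  have hpl := GeodesicFamily.plucker_eq_of_velocity_eq hκ' hvel
  -- Equal velocities have equal base points in `Geod κ`, so the helicoid starts on σ, but at an
  -- unknown parameter t₀.
  obtain ⟨t₀, hcls⟩ := UnitGeodesic.cls_eq_iff.1 (Quotient.exact hvel).1.symm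
  obtain ⟨hψ0, hA, hAA, hAu, hψA, hψd⟩ := hψ.initial hκ'
  have hp := hcls 0
  have hu := UnitGeodesic.vel_of_shift hcls 0
  rw [zero_add] at hp hu
  change ψ 0 0 = φ 0 t₀ at hp
  change (ψ 0).vel 0 = (φ 0).vel t₀ at hu
  rw [hψ0, ((φ 0).eq_cosK_sinK hκ' t₀).1] at hp
  rw [((φ 0).eq_cosK_sinK hκ' t₀).2] at hu
  rw [hψA, hψd, hψ0, hu, hp] at hpl
  rw [hu] at hAu
  rw [hp] at hA
  have hcs := cosK_sq_add hκ' t₀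
  have hcpos := cosK_pos hκ t₀
  rw [cross_rotate κ _ _ hcs] at hpl
  clear hp hu hψA hψd hψ0 hcls hvel hψ
  have hq := (φ 0).mem 0
  have hv := (φ 0).vel_mem_tangent 0
  have hvv : form κ ((φ 0).vel 0) ((φ 0).vel 0) = 1 := (φ 0).unit_speed 0
  have hj := φ.field_mem_tangent 0
  have hd := φ.deriv_field_eq 0
  have hDt := φ.covDeriv_field_mem_tangent hκ' 0
  have hDv := φ.form_covDeriv_field_vel 0
  rw [hd] at hpl
  clear hd
  generalize covDeriv κ (φ 0) φ.field 0 = D at *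
  generalize φ.field 0 = j at *
  generalize φ 0 0 = q at *
  generalize (φ 0).vel 0 = v at *
  generalize cosK κ t₀ = c at *
  generalize sinK κ t₀ = s at *
  -- Orthogonality of A to σ(t₀) and σ'(t₀) is transported back to parameter 0 by inverting the
  -- rotation; for κ = 0 tangency is independent of the point, and c > 0 can be cancelled.
  have hAqv : A ∈ tangent κ q ∧ form κ A v = 0 := by
    by_cases h0 : κ = 0
    · subst h0
      rw [mem_tangent_zero] at *
      refine ⟨hA, ?_⟩
      rw [form_add_right, form_smul_right, form_smul_right] at hAu
      have : c * form 0 A v = 0 := by linarith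
      exact (mul_eq_zero.1 this).resolve_left hcpos.ne'
    · rw [mem_tangent_of_ne h0] at *
      simp only [form_add_right, form_smul_right, form_add_left, form_smul_left, form_comm κ q A,
        form_comm κ v A] at hA hAu ⊢
      constructor
      · linear_combination c * hA - s * hAu - form κ A q * hcs
      · linear_combination κ * s * hA + c * hAu - form κ A v * hcs
  obtain ⟨hAq, hAv⟩ := hAqv
  have hEq : cross κ q A v ∈ tangent κ q := cross_mem_tangent hκ' q A v
  have hEA : form κ (cross κ q A v) A = 0 := form_cross_left hκ' hAq v
  have hEv : form κ (cross κ q A v) v = 0 := form_cross_right hκ' A hv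
  have hEE : form κ (cross κ q A v) (cross κ q A v) = 1 := by
    rw [form_cross_self hκ' hq hAq hv hvv hAv, hAA]
  have hcross : cross κ q j v = cross κ q (j - form κ j v • v) v := by
    rw [← cross_add_smul_right κ (form κ j v) q (j - form κ j v • v) v, sub_add_cancel]
  generalize hE : cross κ q A v = E at *
  -- Expanding A ∧ (-κsq + cv) + (cq + sv) ∧ αE and collecting the terms with q and with v gives
  -- this X and Y; the tangential part of j drops out against v.
  obtain ⟨hX, hY⟩ := eq_zero_of_wedge_add_wedge (X := D - (κ * s) • A - (c * α) • E)
    (Y := (j - form κ j v • v) - c • A + (s * α) • E) hq hv hvv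
    (tangent_sub (tangent_sub hDt (tangent_smul _ hAq)) (tangent_smul _ hEq))
    (by rw [form_sub_left, form_sub_left, form_smul_left, form_smul_left, hDv, hAv, hEv]; ring)
    (tangent_add (tangent_sub (tangent_sub hj (tangent_smul _ hv)) (tangent_smul _ hAq))
      (tangent_smul _ hEq))
    (by
      rw [form_add_left, form_sub_left, form_sub_left, form_smul_left, form_smul_left,
        form_smul_left, hvv, hAv, hEv]; ring)
    (fun i k => by
      have := hpl i k
      simp only [Pi.add_apply, Pi.sub_apply, Pi.smul_apply, smul_eq_mul] at this ⊢
      linear_combination this)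
  have hD : D = (κ * s) • A + (c * α) • E := by
    rw [sub_sub, sub_eq_zero] at hX; exact hX
  have hN : j - form κ j v • v = c • A - (s * α) • E := by
    rw [← sub_eq_zero, ← hY]; abel
  have hND : form κ (j - form κ j v • v) D = 0 := by
    rw [form_sub_left, form_smul_left, form_comm κ v D, hDv, hJ0]; ring
  rw [hN, hD] at hND
  simp only [form_add_right, form_smul_right, form_sub_left, form_smul_left, form_comm κ A E, hEA,
    hEE, hAA] at hND
  have hs : s = 0 := by
    -- Since A and E are orthonormal, the perpendicularity of J(0) and J'(0) becomes this product; κ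
    -- ≤ 0 < α² rules out the first factor.
    have e : (c * (κ - α ^ 2)) * s = 0 := by linear_combination hND
    refine (mul_eq_zero.1 e).resolve_left (mul_ne_zero hcpos.ne' ?_)
    have : 0 < α ^ 2 := by positivity
    rcases hκ with rfl | rfl <;> intro h <;> linarith
  subst hs
  -- With s = 0 the identity is c² = 1, and c > 0 selects the sign.
  have hc : c = 1 := by nlinarith
  subst hc
  have hD' : D = α • E := by rw [hD]; simp
  have hN' : j - form κ j v • v = A := by rw [hN]; simp
  refine ⟨?_, by rw [hcross, hN', hE, hD']⟩
  rw [tnorm, hD', form_smul_left, form_smul_right, hEE, mul_one, Real.sqrt_mul_self_eq_abs]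

end SpaceForm

end

theorem mainTheorem7 (κ : ℝ) (hκ : κ = 0 ∨ κ = 1 ∨ κ = -1) (α : ℝ) (hα : α ≠ 0)
    (σ : SpaceForm.UnitGeodesic κ) (J : SpaceForm.jacobiFields σ)
    (hJ : SpaceForm.form κ (J.1 0) (SpaceForm.covDeriv κ σ J.1 0) = 0) :
    (SpaceForm.tnorm κ (SpaceForm.covDeriv κ σ J.1 0) = |α| ∧
        SpaceForm.covDeriv κ σ J.1 0 =
          α • SpaceForm.cross κ (σ 0) (J.1 0) (σ.vel 0) →
      SpaceForm.transfer σ J ∈ SpaceForm.admissible κ α) ∧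
    (κ = 0 ∨ κ = -1 → SpaceForm.transfer σ J ∈ SpaceForm.admissible κ α →
      SpaceForm.tnorm κ (SpaceForm.covDeriv κ σ J.1 0) = |α| ∧
        SpaceForm.covDeriv κ σ J.1 0 =
          α • SpaceForm.cross κ (σ 0) (J.1 0) (σ.vel 0)) :=
  ⟨fun h => SpaceForm.transfer_mem_admissible hκ hα σ J h.1 h.2,
    fun h h' => SpaceForm.of_transfer_mem_admissible h hα σ J hJ h'⟩
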